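/- A $\{0,1\}$-graphical instance consists of a finite simple graph $G=(V,E)$, whose vertices are the $n$ agents and whose edges are the $m$ indivisible items, together with additive valuations $u_i$ ($i\in V$) such that every agent $i$ values every edge at $0$ or $1$, and at $0$ if the edge is not incident to $i$. An allocation $\Phi=(\Phi_i)_{i\in V}$ is a partition of $E$ into (possibly empty) bundles, one per agent. It is EFX if $u_i(\Phi_i)\ge u_i(\Phi_j\setminus\{g\})$ for all agents $i,j$ and all $g\in\Phi_j$. It is non-wasteful if no item that some agent values positively is given to an agent who values it at $0$. The utilitarian welfare of $\Phi$ is $\sum_{i} u_i(\Phi_i)$. The price of EFX with respect to utilitarian welfare, on a class of instances, is the supremum over the instances of the class in which some allocation has positive welfare of $$\frac{\max\{\sum_i u_i(\Phi_i) : \Phi \text{ an allocation}\}}{\max\{\sum_i u_i(\Phi_i) : \Phi \text{ an EFX allocation}\}}.$$ **Theorem.** 1. Every $\{0,1\}$-graphical instance has a non-wasteful EFX allocation. 2. Such an allocation can be computed in polynomial time: there are a single program for a random access machine (natural-number variables and arrays; constants, reads, writes, additions, truncated subtractions and zero tests at unit cost) and a polynomial $p$ such that, given any $\{0,1\}$-graphical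 instance as $n$, $m$ and a list of its edges with the two endpoints of each edge and their values for it, the program halts after at most $p(n+m)$ steps and outputs the owner of each edge under a non-wasteful EFX allocation. 3. The price of EFX with respect to utilitarian welfare is $1$, both on the class of all $\{0,1\}$-graphical instances and, for all $n$ and $m$ with $1\le m\le\binom n2$, on the class of those with $n$ agents and $m$ items. -/

import Mathlib

open scoped NNReal ENNReal

/-! ### Fair division with additive valuations

`N` is the set of agents, `M` the set of indivisible items, and `u i e` is the value of the item `e`
for the agent `i`.  A (complete) allocation is a function `Φ : M → N` sending every item to its
owner; this is the same thing as a partition of the items into one (possibly empty) bundle per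
agent. -/

namespace FairDivision

variable {N M : Type*}

open Classical in
/-- The set of items that the agent `i` receives. -/
noncomputable def bundle [Fintype M] (Φ : M → N) (i : N) : Finset M :=
  Finset.univ.filter fun e => Φ e = i

/-- The additive valuation: the value of a set `S` of items for the agent `i`. -/
noncomputable def bundleValue (u : N → M → ℝ≥0) (i : N) (S : Finset M) : ℝ≥0 :=
  ∑ e ∈ S, u i e

open Classical in
/-- Envy-freeness up to any item: `u_i(Φ_i) ≥ u_i(Φ_j \ {g})` for all agents `i, j` and all
`g ∈ Φ_j` (including items `g` that `i` does not value). -/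
def IsEFX [Fintype M] (u : N → M → ℝ≥0) (Φ : M → N) : Prop :=
  ∀ i j : N, ∀ g ∈ bundle Φ j,
    bundleValue u i ((bundle Φ j).erase g) ≤ bundleValue u i (bundle Φ i)

/-- No item is wasted: an item that has positive value for somebody is never given to an agent who
has value `0` for it.  (An item that is worthless to everybody has to be given to somebody, and is
not regarded as wasted.) -/
def IsNonWasteful (u : N → M → ℝ≥0) (Φ : M → N) : Prop :=
  ∀ e : M, (∃ i, 0 < u i e) → 0 < u (Φ e) e

/-- Utilitarian social welfare: the sum of the utilities of the agents. -/
noncomputable def welfare [Fintype N] [Fintype M] (u : N → M → ℝ≥0) (Φ : M → N) : ℝ≥0 :=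
  ∑ i, bundleValue u i (bundle Φ i)

/-- The maximum utilitarian welfare of an allocation. -/
noncomputable def maxWelfare [Fintype N] [Fintype M] (u : N → M → ℝ≥0) : ℝ≥0∞ :=
  ⨆ Φ : M → N, (welfare u Φ : ℝ≥0∞)

/-- The maximum utilitarian welfare of an EFX allocation. -/
noncomputable def maxEFXWelfare [Fintype N] [Fintype M] (u : N → M → ℝ≥0) : ℝ≥0∞ :=
  ⨆ (Φ : M → N) (_ : IsEFX u Φ), (welfare u Φ : ℝ≥0∞)

end FairDivision

/-! ### Graphical instances -/

/-- A graphical instance on the agents `V`: the items are the edges of a simple graph, and an agent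
can only have positive value for edges incident to it. -/
structure GraphicalInstance (V : Type*) where
  graph : SimpleGraph V
  value : V → graph.edgeSet → ℝ≥0
  value_eq_zero : ∀ (i : V) (e : graph.edgeSet), i ∉ (e : Sym2 V) → value i e = 0

namespace GraphicalInstance

/-- The items of the instance are the edges of the graph. -/
abbrev Item {V : Type*} (I : GraphicalInstance V) : Type _ := I.graph.edgeSet

noncomputable instance {V : Type*} [Fintype V] (I : GraphicalInstance V) : Fintype I.Item :=
  Fintype.ofFinite _

/-- All item values are `0` or `1`. -/
def IsBinary {V : Type*} (I : GraphicalInstance V) : Prop :=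
  ∀ i e, I.value i e = 0 ∨ I.value i e = 1

/-- The price of EFX with respect to utilitarian welfare on a class `𝒞` of graphical instances: the
supremum of (maximum welfare) / (maximum welfare of an EFX allocation).  The quotient is taken in
`[0, ∞]`: it is `∞` if only the denominator vanishes, and instances in which every allocation has
welfare `0` (quotient `0 / 0 = 0`) do not influence the supremum. -/
noncomputable def priceOfEFX (𝒞 : ∀ n : ℕ, Set (GraphicalInstance (Fin n))) : ℝ≥0∞ :=
  ⨆ (n : ℕ) (I ∈ 𝒞 n), FairDivision.maxWelfare I.value / FairDivision.maxEFXWelfare I.value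

/-- The class of all `{0,1}`-graphical instances. -/
def binaryClass (n : ℕ) : Set (GraphicalInstance (Fin n)) := {I | I.IsBinary}

/-- The class of all `{0,1}`-graphical instances with `n₀` agents and `m₀` items. -/
def binaryClassOfSize (n₀ m₀ n : ℕ) : Set (GraphicalInstance (Fin n)) :=
  {I | n = n₀ ∧ Nat.card I.Item = m₀ ∧ I.IsBinary}

end GraphicalInstance

/-! ### A random access machine

Programs over natural-number variables and arrays, both named by natural numbers (so a program uses
finitely many of them), with unbounded cells.  The primitive operations are constants, access to a
variable, indexed access to an array, addition and truncated subtraction, each at unit cost.  As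
there is no multiplication, `t` steps create only numbers of `O(t)` more bits than the input, so
polynomial time in this model agrees with polynomial time on Turing machines. -/

namespace RAM

/-- Memory contents: `var x` is the variable `x`, `arr a k` is the `k`-th cell of the array `a`. -/
structure State where
  var : ℕ → ℕ
  arr : ℕ → ℕ → ℕ

inductive Expr where
  | const (c : ℕ)
  | var (x : ℕ)
  | read (a : ℕ) (i : Expr)
  | add (e f : Expr)
  | sub (e f : Expr)

/-- The value of an expression; `sub` is truncated subtraction. -/
def Expr.eval (s : State) : Expr → ℕ
  | const c => c
  | var x => s.var x
  | read a i => s.arr a (i.eval s)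
  | add e f => e.eval s + f.eval s
  | sub e f => e.eval s - f.eval s

/-- The number of operations performed in evaluating an expression. -/
def Expr.cost : Expr → ℕ
  | const _ => 1
  | var _ => 1
  | read _ i => i.cost + 1
  | add e f => e.cost + f.cost + 1
  | sub e f => e.cost + f.cost + 1

/-- Programs; a condition `b` counts as true if its value is nonzero. -/
inductive Prog where
  | skip
  | assign (x : ℕ) (e : Expr)
  | write (a : ℕ) (i e : Expr)
  | seq (p q : Prog)
  | ite (b : Expr) (p q : Prog)
  | while (b : Expr) (p : Prog)

/-- `x := v`. -/
def State.setVar (s : State) (x v : ℕ) : State :=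
  { s with var := Function.update s.var x v }

/-- `a[k] := v`. -/
def State.setArr (s : State) (a k v : ℕ) : State :=
  { s with arr := Function.update s.arr a (Function.update (s.arr a) k v) }

/-- `Run p s s' t`: started in the state `s`, the program `p` halts in the state `s'` after exactly
`t` steps. -/
inductive Run : Prog → State → State → ℕ → Prop where
  | skip (s : State) : Run .skip s s 1
  | assign (s : State) (x : ℕ) (e : Expr) :
      Run (.assign x e) s (s.setVar x (e.eval s)) (e.cost + 1)
  | write (s : State) (a : ℕ) (i e : Expr) :
      Run (.write a i e) s (s.setArr a (i.eval s) (e.eval s)) (i.cost + e.cost + 1)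
  | seq {p q : Prog} {s s₁ s₂ : State} {t₁ t₂ : ℕ} :
      Run p s s₁ t₁ → Run q s₁ s₂ t₂ → Run (.seq p q) s s₂ (t₁ + t₂)
  | ite_true {b : Expr} {p q : Prog} {s s' : State} {t : ℕ} :
      b.eval s ≠ 0 → Run p s s' t → Run (.ite b p q) s s' (b.cost + 1 + t)
  | ite_false {b : Expr} {p q : Prog} {s s' : State} {t : ℕ} :
      b.eval s = 0 → Run q s s' t → Run (.ite b p q) s s' (b.cost + 1 + t)
  | while_false {b : Expr} {p : Prog} {s : State} :
      b.eval s = 0 → Run (.while b p) s s (b.cost + 1)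
  | while_true {b : Expr} {p : Prog} {s s₁ s₂ : State} {t₁ t₂ : ℕ} :
      b.eval s ≠ 0 → Run p s s₁ t₁ → Run (.while b p) s₁ s₂ t₂ →
      Run (.while b p) s s₂ (b.cost + 1 + t₁ + t₂)

end RAM

/-! ### Instances as inputs of programs -/

namespace GraphicalInstance

/-- An edge list of the graph with `m` entries: every edge occurs exactly once, and is given by its
two endpoints in some order. -/
structure EdgeList {n : ℕ} (I : GraphicalInstance (Fin n)) (m : ℕ) where
  edge : Fin m ≃ I.Item
  fst : Fin m → Fin n
  snd : Fin m → Fin n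
  edge_eq : ∀ k, (edge k : Sym2 (Fin n)) = s(fst k, snd k)

open Classical in
/-- The initial memory for a `{0,1}`-graphical instance.  Variables `0` and `1` hold the numbers `n`
of agents and `m` of items.  The `k`-th cells of the arrays `0`, `1`, `2`, `3` hold the two
endpoints of the `k`-th edge, its value for the first endpoint and its value for the second.
Everything else is `0`. -/
noncomputable def EdgeList.input {n m : ℕ} {I : GraphicalInstance (Fin n)} (L : I.EdgeList m) :
    RAM.State where
  var
    | 0 => n
    | 1 => m
    | _ => 0
  arr a k :=
    if h : k < m then
      match a with
      | 0 => L.fst ⟨k, h⟩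
      | 1 => L.snd ⟨k, h⟩
      | 2 => if I.value (L.fst ⟨k, h⟩) (L.edge ⟨k, h⟩) = 1 then 1 else 0
      | 3 => if I.value (L.snd ⟨k, h⟩) (L.edge ⟨k, h⟩) = 1 then 1 else 0
      | _ => 0
    else 0

/-- The memory `s` holds the allocation `Φ`: the `k`-th cell of the array `4` is the owner of the
`k`-th edge. -/
def EdgeList.Outputs {n m : ℕ} {I : GraphicalInstance (Fin n)} (L : I.EdgeList m)
    (s : RAM.State) (Φ : I.Item → Fin n) : Prop :=
  ∀ k : Fin m, s.arr 4 k = Φ (L.edge k)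

end GraphicalInstance

/-!
The items are the edges of a simple graph, so two distinct agents have at most one item in common
and, under a non-wasteful allocation, the bundle of one is worth at most `1` to the other.  Hence
only a *poor* agent, one that owns nothing it values, can envy anybody.  By
`GraphicalInstance.isEFX_of_isPoor`, a non-wasteful allocation is EFX as soon as

* whenever a poor agent values an item, that item is the only valued item of its owner;
* items that nobody values go to a poor agent, if there is one (a poor agent owns no valued item, so
  nobody envies it).

The second condition is achieved by moving the worthless items at the end. For the first one,
suppose that a poor agent `i` values an item whose owner has another valued item. Handing the item
to `i` makes `i` no longer poor and leaves its previous owner not poor either, so a non-wasteful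
allocation with the fewest poor agents has the first property
(`FairDivision.exists_nonWasteful_poor_unique`).

The program performs these transfers in a single pass over the items, starting from the allocation
in which every item goes to its first endpoint that values it. The number of valued items of an
agent, its load, never falls to `0` during the pass and rises only from `0` to `1`; therefore an
item that needs no transfer when it is visited needs none later (`EFXProgram.run_transfer`). Loops
are analysed with an invariant rule that also bounds the number of steps
(`RAM.Prog.LoopFree.run_forLoop`).

Finally, with values `0` and `1`, every non-wasteful allocation has the maximum welfare, because
each item contributes `1` if anybody values it. So the two maxima in the price of EFX agree for each
instance, and their quotient is `1` whenever some agent values some item.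
-/

/-! ### Non-wasteful allocations and poor agents -/

namespace FairDivision

variable {N M : Type*}

/-- An agent is poor under `Φ` if it has value `0` for every item that it owns. -/
def IsPoor (u : N → M → ℝ≥0) (Φ : M → N) (i : N) : Prop :=
  ∀ e, Φ e = i → u i e = 0

theorem bundleValue_mono (u : N → M → ℝ≥0) (i : N) {S T : Finset M} (h : S ⊆ T) :
    bundleValue u i S ≤ bundleValue u i T :=
  Finset.sum_le_sum_of_subset h

theorem welfare_eq_sum [Fintype N] [Fintype M] (u : N → M → ℝ≥0) (Φ : M → N) :
    welfare u Φ = ∑ e, u (Φ e) e := by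
  classical
  rw [← Finset.sum_fiberwise Finset.univ Φ]
  refine Finset.sum_congr rfl fun i _ => ?_
  unfold bundleValue bundle
  refine Finset.sum_congr (by ext; simp) fun e he => ?_
  rw [(Finset.mem_filter.1 he).2]

theorem IsNonWasteful.welfare_le [Fintype N] [Fintype M] {u : N → M → ℝ≥0}
    (hu : ∀ i e, u i e = 0 ∨ u i e = 1) {Φ : M → N} (hΦ : IsNonWasteful u Φ) (Ψ : M → N) :
    welfare u Ψ ≤ welfare u Φ := by
  rw [welfare_eq_sum, welfare_eq_sum]
  refine Finset.sum_le_sum fun e _ => ?_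
  rcases hu (Ψ e) e with h | h
  · simp [h]
  · rcases hu (Φ e) e with h' | h'
    · have := hΦ e ⟨Ψ e, by simp [h]⟩
      simp [h'] at this
    · rw [h, h']

theorem IsNonWasteful.maxWelfare_eq [Fintype N] [Fintype M] {u : N → M → ℝ≥0}
    (hu : ∀ i e, u i e = 0 ∨ u i e = 1) {Φ : M → N} (hΦ : IsNonWasteful u Φ) :
    maxWelfare u = welfare u Φ :=
  le_antisymm (iSup_le fun Ψ => by exact_mod_cast hΦ.welfare_le hu Ψ)
    (le_iSup (fun Ψ : M → N => (welfare u Ψ : ℝ≥0∞)) Φ)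

theorem IsNonWasteful.maxEFXWelfare_eq [Fintype N] [Fintype M] {u : N → M → ℝ≥0}
    (hu : ∀ i e, u i e = 0 ∨ u i e = 1) {Φ : M → N} (hΦ : IsNonWasteful u Φ)
    (hE : IsEFX u Φ) : maxEFXWelfare u = welfare u Φ :=
  le_antisymm (iSup₂_le fun Ψ _ => by exact_mod_cast hΦ.welfare_le hu Ψ)
    (le_iSup₂ (f := fun (Ψ : M → N) (_ : IsEFX u Ψ) => (welfare u Ψ : ℝ≥0∞)) Φ hE)

/-- Take an allocation with the fewest poor agents among the non-wasteful ones. If a poor agent `i`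
valued an item `e` whose owner had a further valued item, handing `e` to `i` would leave fewer poor
agents. -/
theorem exists_nonWasteful_poor_unique [Finite N] [Finite M] (u : N → M → ℝ≥0)
    (hne : ∃ Φ, IsNonWasteful u Φ) :
    ∃ Φ, IsNonWasteful u Φ ∧ ∀ i, IsPoor u Φ i → ∀ e, 0 < u i e →
      ∀ e', 0 < u (Φ e') e' → Φ e' = Φ e → e' = e := by
  classical
  obtain ⟨Φ, hΦ, hmin⟩ := Set.exists_min_image {Φ | IsNonWasteful u Φ}
    (fun Φ => {i | IsPoor u Φ i}.ncard) (Set.toFinite _) hne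
  refine ⟨Φ, hΦ, fun i hi e hie e' he' hee => ?_⟩
  by_contra hne
  have hΨ : IsNonWasteful u (Function.update Φ e i) := by
    intro d hd
    rcases eq_or_ne d e with rfl | h
    · simpa using hie
    · simpa [h] using hΦ d hd
  refine absurd (hmin _ hΨ) (not_le.2 (Set.ncard_lt_ncard ?_ (Set.toFinite _)))
  refine ⟨fun x hx d hd => ?_, fun h => ?_⟩
  · rcases eq_or_ne d e with rfl | h
    · have := hx e' (by simp [hne, hee, hd])
      rw [hee, hd] at he'
      simp [this] at he'
    · exact hx d (by simp [h, hd])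
  · have := h hi e (by simp)
    simp [this] at hie

/-- Moving the worthless items to a poor agent, if there is one, changes neither the set of poor
agents nor the owners of the valued items. -/
theorem exists_worthless_to_poor (u : N → M → ℝ≥0) (Φ : M → N) :
    ∃ Ψ : M → N, (∀ e, (∃ i, 0 < u i e) → Ψ e = Φ e) ∧ (∀ i, IsPoor u Ψ i ↔ IsPoor u Φ i) ∧
      ∀ e, (∀ i, u i e = 0) → ∀ i, IsPoor u Ψ i → IsPoor u Ψ (Ψ e) := by
  classical
  by_cases h : ∃ r, IsPoor u Φ r
  · obtain ⟨r, hr⟩ := h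
    let Ψ : M → N := fun e => if ∃ i, 0 < u i e then Φ e else r
    have hΨ : ∀ e, (∃ i, 0 < u i e) → Ψ e = Φ e := fun e he => if_pos he
    have key : ∀ i, IsPoor u Ψ i ↔ IsPoor u Φ i := by
      refine fun i => forall_congr' fun e => ?_
      by_cases he : ∃ i, 0 < u i e
      · rw [hΨ e he]
      · have : u i e = 0 := by simpa using not_exists.1 he i
        simp [this]
    refine ⟨Ψ, hΨ, key, fun e he i _ => ?_⟩
    have : Ψ e = r := if_neg (by simp [he])
    rw [this, key]
    exact hr
  · exact ⟨Φ, fun _ _ => rfl, fun _ => Iff.rfl, fun e _ i hi => absurd ⟨i, hi⟩ h⟩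

end FairDivision

/-! ### Existence of EFX allocations in graphical instances -/

namespace GraphicalInstance

open FairDivision

section

variable {V : Type*} (I : GraphicalInstance V)

theorem mem_of_value_pos {i : V} {e : I.Item} (h : 0 < I.value i e) : i ∈ (e : Sym2 V) := by
  by_contra h'
  simp [I.value_eq_zero i e h'] at h

theorem item_eq_of_value_pos {i j : V} (hij : i ≠ j) {e e' : I.Item} (hi : 0 < I.value i e)
    (hj : 0 < I.value j e) (hi' : 0 < I.value i e') (hj' : 0 < I.value j e') : e = e' := by
  have h := (Sym2.mem_and_mem_iff hij).1 ⟨I.mem_of_value_pos hi, I.mem_of_value_pos hj⟩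
  have h' := (Sym2.mem_and_mem_iff hij).1 ⟨I.mem_of_value_pos hi', I.mem_of_value_pos hj'⟩
  exact Subtype.ext (h.trans h'.symm)

/-- Two distinct agents have at most one item in common, so an agent that is not poor envies nobody;
the hypotheses `hpoor` and `hworthless` say that the bundle of an agent envied by a poor agent
consists of a single item. -/
theorem isEFX_of_isPoor [Fintype V] (hI : I.IsBinary) {Φ : I.Item → V}
    (hΦ : IsNonWasteful I.value Φ)
    (hpoor : ∀ i, IsPoor I.value Φ i → ∀ e, 0 < I.value i e →
      ∀ e', 0 < I.value (Φ e') e' → Φ e' = Φ e → e' = e)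
    (hworthless : ∀ e, (∀ i, I.value i e = 0) →
      ∀ i, IsPoor I.value Φ i → IsPoor I.value Φ (Φ e)) :
    IsEFX I.value Φ := by
  intro i j g hg
  have memb : ∀ {k : V} {e}, e ∈ bundle Φ k ↔ Φ e = k := by simp [bundle]
  suffices h : ∀ S : Finset I.Item, (∀ e ∈ S, e ≠ g ∧ Φ e = j) →
      bundleValue I.value i S ≤ bundleValue I.value i (bundle Φ i) from
    h _ fun e he => by simpa [memb] using he
  intro S hS
  rw [memb] at hg
  rcases eq_or_ne i j with rfl | hij
  · exact bundleValue_mono _ _ fun e he => memb.2 (hS e he).2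
  by_cases hi : IsPoor I.value Φ i
  · refine le_of_eq_of_le (Finset.sum_eq_zero fun e he => ?_) zero_le
    obtain ⟨hne, hej⟩ := hS e he
    by_contra hv
    have hv : 0 < I.value i e := pos_iff_ne_zero.2 hv
    have hown := hΦ e ⟨i, hv⟩
    by_cases hgv : ∃ k, 0 < I.value k g
    · exact hne (hpoor i hi e hv g (hΦ g hgv) (hg.trans hej.symm)).symm
    · have := hworthless g (by simpa using hgv) i hi e (hej.trans hg.symm)
      rw [hg, ← hej] at this
      exact hown.ne' this
  · have h1 : 1 ≤ bundleValue I.value i (bundle Φ i) := by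
      simp only [IsPoor, not_forall] at hi
      obtain ⟨d, hd, hd0⟩ := hi
      rw [← (hI i d).resolve_left hd0]
      exact Finset.single_le_sum (f := I.value i) (fun _ _ => zero_le) (memb.2 hd)
    refine le_trans ?_ h1
    have own : ∀ {d}, d ∈ S → 0 < I.value i d → 0 < I.value j d := by
      intro d hd hdv
      have := hΦ d ⟨i, hdv⟩
      rwa [(hS d hd).2] at this
    by_cases h : ∃ e ∈ S, 0 < I.value i e
    · obtain ⟨e, he, hv⟩ := h
      have : bundleValue I.value i S = I.value i e := by
        refine Finset.sum_eq_single_of_mem e he fun d hd hde => ?_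
        by_contra h0
        have h0 := pos_iff_ne_zero.2 h0
        exact hde (I.item_eq_of_value_pos hij h0 (own hd h0) hv (own he hv))
      rw [this]
      rcases hI i e with h | h <;> simp [h]
    · push Not at h
      exact le_of_eq_of_le (Finset.sum_eq_zero fun e he => nonpos_iff_eq_zero.1 (h e he)) zero_le

theorem exists_isNonWasteful : ∃ Φ, IsNonWasteful I.value Φ := by
  classical
  refine ⟨fun e => if h : ∃ i, 0 < I.value i e then h.choose else (e : Sym2 V).out.1,
    fun e he => ?_⟩
  simp only [dif_pos he]
  exact he.choose_spec

theorem exists_isNonWasteful_isEFX [Fintype V] (hI : I.IsBinary) :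
    ∃ Φ, IsNonWasteful I.value Φ ∧ IsEFX I.value Φ := by
  obtain ⟨Φ, hΦ, hpoor⟩ := exists_nonWasteful_poor_unique I.value I.exists_isNonWasteful
  obtain ⟨Ψ, hΨ, hiff, hworthless⟩ := exists_worthless_to_poor I.value Φ
  have hnw : IsNonWasteful I.value Ψ := fun e he => by rw [hΨ e he]; exact hΦ e he
  refine ⟨Ψ, hnw, I.isEFX_of_isPoor hI hnw (fun i hi e he e' he' hee => ?_) hworthless⟩
  rw [hΨ e' ⟨_, he'⟩, hΨ e ⟨_, he⟩] at hee
  rw [hΨ e' ⟨_, he'⟩] at he'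
  exact hpoor i ((hiff i).1 hi) e he e' he' hee

theorem maxWelfare_div_maxEFXWelfare_eq_one [Fintype V] (hI : I.IsBinary) {i : V} {e : I.Item}
    (he : 0 < I.value i e) : maxWelfare I.value / maxEFXWelfare I.value = 1 := by
  obtain ⟨Φ, hΦ, hE⟩ := I.exists_isNonWasteful_isEFX hI
  rw [hΦ.maxWelfare_eq hI, hΦ.maxEFXWelfare_eq hI hE]
  refine ENNReal.div_self ?_ ENNReal.coe_ne_top
  rw [ENNReal.coe_ne_zero, welfare_eq_sum]
  exact ((hΦ e ⟨i, he⟩).trans_le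
    (Finset.single_le_sum (f := fun e => I.value (Φ e) e) (fun _ _ => zero_le)
      (Finset.mem_univ e))).ne'

theorem maxWelfare_div_maxEFXWelfare_le_one [Fintype V] (hI : I.IsBinary) :
    maxWelfare I.value / maxEFXWelfare I.value ≤ 1 := by
  obtain ⟨Φ, hΦ, hE⟩ := I.exists_isNonWasteful_isEFX hI
  rw [hΦ.maxWelfare_eq hI, hΦ.maxEFXWelfare_eq hI hE]
  exact ENNReal.div_self_le_one

end

/-! ### The price of EFX -/

theorem priceOfEFX_eq_one {𝒞 : ∀ n : ℕ, Set (GraphicalInstance (Fin n))}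
    (h𝒞 : ∀ n, ∀ I ∈ 𝒞 n, I.IsBinary) {n : ℕ} {I : GraphicalInstance (Fin n)} (hI : I ∈ 𝒞 n)
    {i : Fin n} {e : I.Item} (he : 0 < I.value i e) : priceOfEFX 𝒞 = 1 := by
  refine le_antisymm (iSup_le fun k => iSup₂_le fun J hJ =>
    J.maxWelfare_div_maxEFXWelfare_le_one (h𝒞 k J hJ)) ?_
  rw [← I.maxWelfare_div_maxEFXWelfare_eq_one (h𝒞 n I hI) he]
  exact le_iSup_of_le n (le_iSup₂_of_le I hI le_rfl)

open Classical in
/-- The instance on the graph `G` in which every agent values every incident edge. -/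
noncomputable def ofGraph {V : Type*} (G : SimpleGraph V) : GraphicalInstance V where
  graph := G
  value i e := if i ∈ (e : Sym2 V) then 1 else 0
  value_eq_zero _ _ h := if_neg h

theorem exists_graph_card_edgeSet {n m : ℕ} (hm : m ≤ n.choose 2) :
    ∃ G : SimpleGraph (Fin n), Nat.card G.edgeSet = m := by
  classical
  have h : m ≤ (⊤ : SimpleGraph (Fin n)).edgeFinset.card := by
    rwa [SimpleGraph.card_edgeFinset_top_eq_card_choose_two, Fintype.card_fin]
  obtain ⟨S, hS, hcard⟩ := Finset.exists_subset_card_eq h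
  refine ⟨SimpleGraph.fromEdgeSet S, ?_⟩
  have : (SimpleGraph.fromEdgeSet (S : Set (Sym2 (Fin n)))).edgeSet = S := by
    rw [SimpleGraph.edgeSet_fromEdgeSet, sdiff_eq_left, Set.disjoint_left]
    intro e he hd
    have := hS he
    rw [SimpleGraph.mem_edgeFinset] at this
    exact SimpleGraph.not_isDiag_of_mem_edgeSet _ this hd
  rw [this]
  simpa using hcard

theorem priceOfEFX_binaryClassOfSize {n m : ℕ} (h1 : 1 ≤ m) (hm : m ≤ n.choose 2) :
    priceOfEFX (binaryClassOfSize n m) = 1 ∧ priceOfEFX binaryClass = 1 := by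
  obtain ⟨G, hG⟩ := exists_graph_card_edgeSet hm
  have hbin : (ofGraph G).IsBinary := fun i e => by
    by_cases h : i ∈ (e : Sym2 (Fin n)) <;> simp [ofGraph, h]
  have hne : Nonempty G.edgeSet := (Nat.card_pos_iff.1 (by omega)).1
  obtain ⟨e⟩ := hne
  have he : 0 < (ofGraph G).value (e : Sym2 (Fin n)).out.1 e := by
    simp [ofGraph, Sym2.out_fst_mem]
  exact ⟨priceOfEFX_eq_one (fun _ _ h => h.2.2) (I := ofGraph G) ⟨rfl, hG, hbin⟩ he,
    priceOfEFX_eq_one (fun _ _ h => h) (I := ofGraph G) hbin he⟩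

end GraphicalInstance

/-! ### Running programs -/

namespace RAM

/-- The program contains no `while`. -/
def Prog.LoopFree : Prog → Prop
  | .skip | .assign _ _ | .write _ _ _ => True
  | .seq p q | .ite _ p q => p.LoopFree ∧ q.LoopFree
  | .while _ _ => False

/-- The effect of a loop-free program on the memory (the value at `while` is immaterial). -/
def Prog.exec : Prog → State → State
  | .skip, s => s
  | .assign x e, s => s.setVar x (e.eval s)
  | .write a i e, s => s.setArr a (i.eval s) (e.eval s)
  | .seq p q, s => q.exec (p.exec s)
  | .ite b p q, s => if b.eval s = 0 then q.exec s else p.exec s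
  | .while _ _, s => s

/-- An upper bound for the number of steps of a loop-free program. -/
def Prog.bound : Prog → ℕ
  | .skip => 1
  | .assign _ e => e.cost + 1
  | .write _ i e => i.cost + e.cost + 1
  | .seq p q => p.bound + q.bound
  | .ite b p q => b.cost + 1 + (p.bound + q.bound)
  | .while _ _ => 0

theorem Prog.LoopFree.run {p : Prog} (hp : p.LoopFree) (s : State) :
    ∃ t ≤ p.bound, Run p s (p.exec s) t := by
  induction p generalizing s with
  | skip => exact ⟨_, le_rfl, .skip s⟩
  | assign x e => exact ⟨_, le_rfl, .assign s x e⟩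
  | write a i e => exact ⟨_, le_rfl, .write s a i e⟩
  | seq p q ihp ihq =>
    obtain ⟨t₁, h₁, r₁⟩ := ihp hp.1 s
    obtain ⟨t₂, h₂, r₂⟩ := ihq hp.2 (p.exec s)
    exact ⟨_, Nat.add_le_add h₁ h₂, .seq r₁ r₂⟩
  | ite b p q ihp ihq =>
    by_cases hb : b.eval s = 0
    · obtain ⟨t, h, r⟩ := ihq hp.2 s
      refine ⟨_, ?_, by simpa [exec, hb] using Run.ite_false hb r⟩
      simp only [bound]
      omega
    · obtain ⟨t, h, r⟩ := ihp hp.1 s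
      refine ⟨_, ?_, by simpa [exec, hb] using Run.ite_true hb r⟩
      simp only [bound]
      omega
  | _ => exact hp.elim

/-- `for x := 0, …, N - 1 do p`, where `N` is the value of the variable `b`. -/
def Prog.forLoop (x b : ℕ) (p : Prog) : Prog :=
  .seq (.assign x (.const 0))
    (.while (.sub (.var b) (.var x)) (.seq p (.assign x (.add (.var x) (.const 1)))))

/-- The rule for loops with an invariant: `Inv k` describes the memory, apart from the counter, when
the counter is `k`. -/
theorem Prog.LoopFree.run_forLoop {x b : ℕ} {p : Prog} (hp : p.LoopFree) {N : ℕ}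
    {Inv : ℕ → State → Prop}
    (hb : ∀ k s, Inv k s → s.var b = N)
    (hx : ∀ k s v, Inv k s → Inv k (s.setVar x v))
    (hstep : ∀ k s, k < N → s.var x = k → Inv k s →
      (p.exec s).var x = k ∧ Inv (k + 1) (p.exec s))
    {s : State} (h0 : Inv 0 s) :
    ∃ s' t, t ≤ (p.bound + 8) * N + 6 ∧ Run (forLoop x b p) s s' t ∧ Inv N s' := by
  have key : ∀ d k s, k + d = N → s.var x = k → Inv k s →
      ∃ s' t, t ≤ (p.bound + 8) * d + 4 ∧
        Run (.while (.sub (.var b) (.var x)) (.seq p (.assign x (.add (.var x) (.const 1)))))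
          s s' t ∧ Inv N s' := by
    intro d
    induction d with
    | zero =>
      intro k s hk hxk hI
      have hg : (Expr.sub (.var b) (.var x)).eval s = 0 := by
        simp only [Expr.eval, hb k s hI, hxk]
        omega
      exact ⟨s, _, le_of_eq rfl |>.trans (Nat.le_add_left _ _), .while_false hg, by
        rwa [← hk]⟩
    | succ d ih =>
      intro k s hk hxk hI
      have hg : (Expr.sub (.var b) (.var x)).eval s ≠ 0 := by
        simp only [Expr.eval, hb k s hI, hxk]
        omega
      obtain ⟨t₁, ht₁, r₁⟩ := hp.run s
      obtain ⟨hx', hI'⟩ := hstep k s (by omega) hxk hI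
      obtain ⟨s', t₂, ht₂, r₂, hN⟩ := ih (k + 1) ((p.exec s).setVar x ((p.exec s).var x + 1))
        (by omega) (by simp [State.setVar, hx']) (hx _ _ _ hI')
      refine ⟨s', _, ?_, .while_true hg (.seq r₁ (.assign _ _ _)) r₂, hN⟩
      simp only [Expr.cost]
      linarith
  obtain ⟨s', t, ht, r, hN⟩ := key N 0 (s.setVar x 0) (by omega) (by simp [State.setVar])
    (hx _ _ _ h0)
  refine ⟨s', _, ?_, .seq (.assign _ _ _) r, hN⟩
  simp only [Expr.cost]
  omega

end RAM

/-! ### A program for non-wasteful EFX allocations -/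

namespace EFXProgram

open RAM

/-- A list of items as it is held in memory: the two endpoints of the `j`-th item and its values for
them. -/
structure ItemList where
  fst : ℕ → ℕ
  snd : ℕ → ℕ
  fstValue : ℕ → ℕ
  sndValue : ℕ → ℕ

namespace ItemList

variable (D : ItemList)

/-- Some agent values the `j`-th item. -/
def Valued (j : ℕ) : Prop := D.fstValue j ≠ 0 ∨ D.sndValue j ≠ 0

instance : DecidablePred D.Valued := fun _ => inferInstanceAs (Decidable (_ ∨ _))

/-- The number of valued items among the first `k` that the agent `i` owns. -/
def load (own : ℕ → ℕ) (k i : ℕ) : ℕ :=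
  ((Finset.range k).filter fun j => D.Valued j ∧ own j = i).card

variable {D} {own own' : ℕ → ℕ} {k m i j : ℕ}

theorem load_congr (h : ∀ j < k, D.Valued j → own j = own' j) :
    D.load own k i = D.load own' k i := by
  unfold load
  congr 1
  refine Finset.filter_congr fun j hj => and_congr_right fun hv => ?_
  rw [h j (Finset.mem_range.1 hj) hv]

theorem load_zero : D.load own 0 i = 0 := rfl

theorem load_succ :
    D.load own (k + 1) i = D.load own k i + if D.Valued k ∧ own k = i then 1 else 0 := by
  simp only [load, Finset.card_filter, Finset.sum_range_succ]

theorem load_update (hk : k < m) (hv : D.Valued k) (v : ℕ) :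
    D.load (Function.update own k v) m i + (if own k = i then 1 else 0) =
      D.load own m i + if v = i then 1 else 0 := by
  have hk' := Finset.mem_range.2 hk
  simp only [load, Finset.card_filter]
  rw [← Finset.add_sum_erase _ _ hk', ← Finset.add_sum_erase _ _ hk']
  have : ∀ x ∈ (Finset.range m).erase k,
      (if D.Valued x ∧ Function.update own k v x = i then 1 else 0) =
        if D.Valued x ∧ own x = i then 1 else 0 := fun x hx => by
    rw [Function.update_of_ne (Finset.ne_of_mem_erase hx)]
  rw [Finset.sum_congr rfl this]
  simp only [hv, true_and, Function.update_self]
  omega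

theorem load_eq_zero : D.load own m i = 0 ↔ ∀ j < m, D.Valued j → own j ≠ i := by
  simp [load, Finset.filter_eq_empty_iff]

theorem eq_of_load_le_one (h : D.load own m (own j) ≤ 1) (hj : j < m) (hk : k < m)
    (hvj : D.Valued j) (hvk : D.Valued k) (hjk : own k = own j) : k = j :=
  Finset.card_le_one.1 h k (by simp [*]) j (by simp [*])

variable (D)

/-- The `j`-th item belongs to its first endpoint if that endpoint values it, and otherwise to its
second endpoint if that one values it. -/
def Initial (own : ℕ → ℕ) (j : ℕ) : Prop :=
  (D.fstValue j ≠ 0 → own j = D.fst j) ∧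
    (D.fstValue j = 0 → D.sndValue j ≠ 0 → own j = D.snd j)

/-- The owner of the `j`-th item values it, and if the other endpoint values it and has load `0`,
then the owner has load at most `1`; here `c` is the vector of loads.  For an item that was handed
to its second endpoint, the stronger condition that the first endpoint has positive load is
imposed. -/
def Settled (own c : ℕ → ℕ) (j : ℕ) : Prop :=
  (D.fstValue j ≠ 0 ∧ own j = D.fst j ∧
      (D.sndValue j ≠ 0 → c (D.snd j) = 0 → c (D.fst j) ≤ 1)) ∨
    (D.sndValue j ≠ 0 ∧ own j = D.snd j ∧ (D.fstValue j ≠ 0 → c (D.fst j) ≠ 0)) ∨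
    ¬ D.Valued j

variable {D}

/-- Being settled persists if loads never fall to `0` and never rise above `1`. -/
theorem Settled.mono {c c' : ℕ → ℕ} (h : D.Settled own c j) (hown : own' j = own j)
    (h0 : ∀ i, c' i = 0 → c i = 0) (h1 : ∀ i, c i ≤ 1 → c' i ≤ 1) : D.Settled own' c' j := by
  rcases h with ⟨ha, ho, h⟩ | ⟨hb, ho, h⟩ | h
  · exact .inl ⟨ha, hown.trans ho, fun hb hc => h1 _ (h hb (h0 _ hc))⟩
  · exact .inr (.inl ⟨hb, hown.trans ho, fun ha hc => h ha (h0 _ hc)⟩)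
  · exact .inr (.inr h)

theorem Settled.congr {c : ℕ → ℕ} (h : D.Settled own c j) (hown : D.Valued j → own' j = own j) :
    D.Settled own' c j := by
  by_cases hv : D.Valued j
  · exact h.mono (hown hv) (fun _ => id) fun _ => id
  · exact .inr (.inr hv)

end ItemList

/-- The memory `s` holds the numbers `n` of agents and `m` of items and the item list `D`. -/
structure HasInput (n m : ℕ) (D : ItemList) (s : State) : Prop where
  var0 : s.var 0 = n
  var1 : s.var 1 = m
  arr0 : s.arr 0 = D.fst
  arr1 : s.arr 1 = D.snd
  arr2 : s.arr 2 = D.fstValue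
  arr3 : s.arr 3 = D.sndValue

/-- Give the current item to an agent who values it, preferably its first endpoint.  Array `4` holds
the owners, array `5` the loads, and variable `2` is the index of the current item. -/
def assignBody : Prog :=
  .ite (.read 2 (.var 2))
    (.seq (.write 4 (.var 2) (.read 0 (.var 2)))
      (.write 5 (.read 0 (.var 2)) (.add (.read 5 (.read 0 (.var 2))) (.const 1))))
    (.ite (.read 3 (.var 2))
      (.seq (.write 4 (.var 2) (.read 1 (.var 2)))
        (.write 5 (.read 1 (.var 2)) (.add (.read 5 (.read 1 (.var 2))) (.const 1))))
      .skip)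

/-- If both endpoints value the current item, the second one has load `0` and the first one load at
least `2`, hand the item to the second one. -/
def transferBody : Prog :=
  .ite (.read 2 (.var 2))
    (.ite (.read 3 (.var 2))
      (.ite (.read 5 (.read 1 (.var 2))) .skip
        (.ite (.sub (.read 5 (.read 0 (.var 2))) (.const 1))
          (.seq (.write 4 (.var 2) (.read 1 (.var 2)))
            (.seq (.write 5 (.read 1 (.var 2)) (.const 1))
              (.write 5 (.read 0 (.var 2)) (.sub (.read 5 (.read 0 (.var 2))) (.const 1)))))
          .skip))
      .skip)
    .skip

/-- Record in variable `3` that the current agent has load `0`, if this is so. -/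
def findBody : Prog :=
  .ite (.read 5 (.var 2)) .skip (.assign 3 (.var 2))

/-- Give the current item to the agent in variable `3` if nobody values it. -/
def disposeBody : Prog :=
  .ite (.add (.read 2 (.var 2)) (.read 3 (.var 2))) .skip (.write 4 (.var 2) (.var 3))

/-- A program for non-wasteful EFX allocations: assign the valued items, transfer some of them in a
single pass, and give the worthless items to an agent with load `0`, if there is one. -/
def program : Prog :=
  .seq (.forLoop 2 1 assignBody)
    (.seq (.forLoop 2 1 transferBody) (.seq (.forLoop 2 0 findBody) (.forLoop 2 1 disposeBody)))

variable {n m : ℕ} {D : ItemList}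

/-! ### The loops of the program -/

theorem run_assign {s : State} (hs : HasInput n m D s) (h3 : s.var 3 = 0)
    (h5 : ∀ i, s.arr 5 i = 0) :
    ∃ s' t, t ≤ (assignBody.bound + 8) * m + 6 ∧ Run (.forLoop 2 1 assignBody) s s' t ∧
      HasInput n m D s' ∧ s'.var 3 = 0 ∧ (∀ j < m, D.Initial (s'.arr 4) j) ∧
      ∀ i, s'.arr 5 i = D.load (s'.arr 4) m i := by
  have hp : assignBody.LoopFree := by simp [assignBody, Prog.LoopFree]
  refine hp.run_forLoop (Inv := fun k s' => HasInput n m D s' ∧ s'.var 3 = 0 ∧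
    (∀ j < k, D.Initial (s'.arr 4) j) ∧ ∀ i, s'.arr 5 i = D.load (s'.arr 4) k i)
    (fun k s h => h.1.var1) (fun k s v h => ?_) (fun k s hk hx h => ?_)
    ⟨hs, h3, by simp, by simpa [ItemList.load_zero] using h5⟩
  · obtain ⟨⟨h0, h1, h2, h3, h4, h5⟩, h⟩ := h
    exact ⟨⟨by simpa [State.setVar], by simpa [State.setVar], h2, h3, h4, h5⟩,
      by simpa [State.setVar] using h⟩
  · obtain ⟨⟨h0, h1, h2, h3, h4, h5⟩, h6, h7, h8⟩ := h
    -- Appending an owner `v` who values the item `k`.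
    have step : ∀ v, D.Valued k →
        (∀ j < k, D.Initial (Function.update (s.arr 4) k v) j) ∧
        ∀ i, Function.update (s.arr 5) v (s.arr 5 v + 1) i =
          D.load (Function.update (s.arr 4) k v) (k + 1) i := by
      refine fun v hv => ⟨fun j hj => ?_, fun i => ?_⟩
      · have := h7 j hj
        simpa [ItemList.Initial, Function.update_of_ne hj.ne] using this
      · rw [ItemList.load_succ, ItemList.load_congr (own' := s.arr 4)
          (fun j hj _ => Function.update_of_ne hj.ne _ _)]
        rcases eq_or_ne i v with rfl | hi
        · simp [hv, h8]
        · simp [hi, hi.symm, h8]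
    by_cases ha : D.fstValue k = 0
    · by_cases hb : D.sndValue k = 0
      · have hv : ¬ D.Valued k := by simp [ItemList.Valued, ha, hb]
        have : assignBody.exec s = s := by
          simp [assignBody, Prog.exec, Expr.eval, h4, h5, hx, ha, hb]
        rw [this]
        refine ⟨hx, ⟨h0, h1, h2, h3, h4, h5⟩, h6, fun j hj => ?_, fun i => ?_⟩
        · rcases Nat.lt_succ_iff_lt_or_eq.1 hj with hj | rfl
          · exact h7 j hj
          · simp [ItemList.Initial, ha, hb]
        · simp [ItemList.load_succ, hv, h8]
      · obtain ⟨s1, s2⟩ := step (D.snd k) (.inr hb)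
        have : assignBody.exec s =
            (s.setArr 4 k (D.snd k)).setArr 5 (D.snd k) (s.arr 5 (D.snd k) + 1) := by
          simp [assignBody, Prog.exec, Expr.eval, h3, h4, h5, hx, ha, hb, State.setArr]
        rw [this]
        refine ⟨hx, ⟨h0, h1, ?_, ?_, ?_, ?_⟩, h6, fun j hj => ?_, ?_⟩
        · simpa [State.setArr]
        · simpa [State.setArr]
        · simpa [State.setArr]
        · simpa [State.setArr]
        · rcases Nat.lt_succ_iff_lt_or_eq.1 hj with hj | rfl
          · simpa [State.setArr] using s1 j hj
          · simp [State.setArr, ItemList.Initial, ha]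
        · simpa [State.setArr] using s2
    · obtain ⟨s1, s2⟩ := step (D.fst k) (.inl ha)
      have : assignBody.exec s =
          (s.setArr 4 k (D.fst k)).setArr 5 (D.fst k) (s.arr 5 (D.fst k) + 1) := by
        simp [assignBody, Prog.exec, Expr.eval, h2, h4, hx, ha, State.setArr]
      rw [this]
      refine ⟨hx, ⟨h0, h1, ?_, ?_, ?_, ?_⟩, h6, fun j hj => ?_, ?_⟩
      · simpa [State.setArr]
      · simpa [State.setArr]
      · simpa [State.setArr]
      · simpa [State.setArr]
      · rcases Nat.lt_succ_iff_lt_or_eq.1 hj with hj | rfl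
        · simpa [State.setArr] using s1 j hj
        · simp [State.setArr, ItemList.Initial, ha]
      · simpa [State.setArr] using s2

/-- One pass over the items suffices, because loads never fall to `0` and rise only from `0` to `1`:
an item that is settled when it has been visited remains settled. -/
theorem run_transfer {s : State} (hs : HasInput n m D s) (h3 : s.var 3 = 0)
    (hinit : ∀ j < m, D.Initial (s.arr 4) j) (h5 : ∀ i, s.arr 5 i = D.load (s.arr 4) m i) :
    ∃ s' t, t ≤ (transferBody.bound + 8) * m + 6 ∧ Run (.forLoop 2 1 transferBody) s s' t ∧
      HasInput n m D s' ∧ s'.var 3 = 0 ∧ (∀ j < m, D.Settled (s'.arr 4) (s'.arr 5) j) ∧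
      ∀ i, s'.arr 5 i = D.load (s'.arr 4) m i := by
  have hp : transferBody.LoopFree := by simp [transferBody, Prog.LoopFree]
  suffices h : ∃ s' t, t ≤ (transferBody.bound + 8) * m + 6 ∧
      Run (.forLoop 2 1 transferBody) s s' t ∧
      HasInput n m D s' ∧ s'.var 3 = 0 ∧ (∀ j < m, D.Settled (s'.arr 4) (s'.arr 5) j) ∧
      (∀ j < m, m ≤ j → D.Initial (s'.arr 4) j) ∧
      ∀ i, s'.arr 5 i = D.load (s'.arr 4) m i by
    obtain ⟨s', t, h1, h2, h3, h4, h5, -, h6⟩ := h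
    exact ⟨s', t, h1, h2, h3, h4, h5, h6⟩
  refine hp.run_forLoop (Inv := fun k s' => HasInput n m D s' ∧ s'.var 3 = 0 ∧
    (∀ j < k, D.Settled (s'.arr 4) (s'.arr 5) j) ∧
    (∀ j < m, k ≤ j → D.Initial (s'.arr 4) j) ∧ ∀ i, s'.arr 5 i = D.load (s'.arr 4) m i)
    (fun k s h => h.1.var1) (fun k s v h => ?_) (fun k s hk hx h => ?_)
    ⟨hs, h3, by simp, fun j hj _ => hinit j hj, h5⟩
  · obtain ⟨⟨h0, h1, h2, h3, h4, h5⟩, h⟩ := h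
    exact ⟨⟨by simpa [State.setVar], by simpa [State.setVar], h2, h3, h4, h5⟩,
      by simpa [State.setVar] using h⟩
  · obtain ⟨⟨h0, h1, h2, h3, h4, h5⟩, h6, h7, h8, h9⟩ := h
    have hk0 := h8 k hk le_rfl
    by_cases hmove : D.fstValue k ≠ 0 ∧ D.sndValue k ≠ 0 ∧ s.arr 5 (D.snd k) = 0 ∧
        2 ≤ s.arr 5 (D.fst k)
    · obtain ⟨ha, hb, hc0, hc2⟩ := hmove
      have hne : D.fst k ≠ D.snd k := fun h => by rw [h, hc0] at hc2; omega
      have hsub : ¬ s.arr 5 (D.fst k) - 1 = 0 := by omega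
      have : transferBody.exec s = ((s.setArr 4 k (D.snd k)).setArr 5 (D.snd k) 1).setArr 5
          (D.fst k) (s.arr 5 (D.fst k) - 1) := by
        simp [transferBody, Prog.exec, Expr.eval, h2, h3, h4, h5, hx, ha, hb, hc0, State.setArr,
          hne, hsub]
      rw [this]
      have hc : ∀ i, Function.update (Function.update (s.arr 5) (D.snd k) 1)
          (D.fst k) (s.arr 5 (D.fst k) - 1) i =
          if i = D.fst k then s.arr 5 i - 1 else if i = D.snd k then 1 else s.arr 5 i := by
        intro i
        simp only [Function.update_apply]
        split_ifs with h h' <;> simp_all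
      have hset : ∀ j, j ≠ k → D.Settled (s.arr 4) (s.arr 5) j →
          D.Settled (Function.update (s.arr 4) k (D.snd k))
            (Function.update (Function.update (s.arr 5) (D.snd k) 1)
              (D.fst k) (s.arr 5 (D.fst k) - 1)) j := by
        refine fun j hj h => h.mono (Function.update_of_ne hj _ _) (fun i => ?_) fun i => ?_
        · rw [hc]
          split_ifs with h h'
          · subst h; omega
          · simp
          · exact id
        · rw [hc]
          split_ifs with h h' <;> omega
      refine ⟨hx, ⟨h0, h1, ?_, ?_, ?_, ?_⟩, h6, fun j hj => ?_, fun j hj hkj => ?_, fun i => ?_⟩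
      · simpa [State.setArr]
      · simpa [State.setArr]
      · simpa [State.setArr]
      · simpa [State.setArr]
      · rcases Nat.lt_succ_iff_lt_or_eq.1 hj with hj | rfl
        · simpa [State.setArr] using hset j hj.ne (h7 j hj)
        · refine .inr (.inl ⟨hb, by simp [State.setArr], fun _ => ?_⟩)
          simpa [State.setArr] using hsub
      · have := h8 j hj (by omega)
        have hjk : j ≠ k := by omega
        simpa [State.setArr, ItemList.Initial, Function.update_of_ne hjk] using this
      · have hl := ItemList.load_update (own := s.arr 4) (i := i) hk (.inl ha) (D.snd k)
        rw [hk0.1 ha, ← h9] at hl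
        have : (((s.setArr 4 k (D.snd k)).setArr 5 (D.snd k) 1).setArr 5
          (D.fst k) (s.arr 5 (D.fst k) - 1)).arr 5 i = if i = D.fst k then s.arr 5 i - 1 else
            if i = D.snd k then 1 else s.arr 5 i := by
          rw [← hc]; simp [State.setArr]
        rw [this]
        have h4' : (((s.setArr 4 k (D.snd k)).setArr 5 (D.snd k) 1).setArr 5
          (D.fst k) (s.arr 5 (D.fst k) - 1)).arr 4 = Function.update (s.arr 4) k (D.snd k) := by
          simp [State.setArr]
        rw [h4']
        rcases eq_or_ne i (D.fst k) with rfl | hif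
        · simp only [if_true, hne.symm, if_false] at hl ⊢
          omega
        · rcases eq_or_ne i (D.snd k) with rfl | his
          · simp only [hif, hif.symm, if_true, if_false] at hl ⊢
            omega
          · simp only [hif, hif.symm, his, his.symm, if_false] at hl ⊢
            omega
    · have : transferBody.exec s = s := by
        simp only [transferBody, Prog.exec, Expr.eval, h2, h3, h4, h5, hx]
        split_ifs <;> first | rfl | (exfalso; apply hmove; omega)
      rw [this]
      refine ⟨hx, ⟨h0, h1, h2, h3, h4, h5⟩, h6, fun j hj => ?_, fun j hj hkj => h8 j hj (by omega),
        h9⟩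
      rcases Nat.lt_succ_iff_lt_or_eq.1 hj with hj | rfl
      · exact h7 j hj
      · by_cases ha : D.fstValue j = 0
        · by_cases hb : D.sndValue j = 0
          · exact .inr (.inr (by simp [ItemList.Valued, ha, hb]))
          · exact .inr (.inl ⟨hb, hk0.2 ha hb, fun h => absurd ha h⟩)
        · refine .inl ⟨ha, hk0.1 ha, fun hb hc => ?_⟩
          by_contra hc2
          exact hmove ⟨ha, hb, hc, by omega⟩

theorem run_find {s : State} (hs : HasInput n m D s) (h3 : s.var 3 = 0) :
    ∃ s' t, t ≤ (findBody.bound + 8) * n + 6 ∧ Run (.forLoop 2 0 findBody) s s' t ∧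
      HasInput n m D s' ∧ s'.arr = s.arr ∧ (s'.var 3 = 0 ∨ s'.var 3 < n) ∧
      ∀ i < n, s.arr 5 i = 0 → s.arr 5 (s'.var 3) = 0 := by
  have hp : findBody.LoopFree := by simp [findBody, Prog.LoopFree]
  refine hp.run_forLoop (Inv := fun k s' => HasInput n m D s' ∧ s'.arr = s.arr ∧
    (s'.var 3 = 0 ∨ s'.var 3 < n) ∧ ∀ i < k, s.arr 5 i = 0 → s.arr 5 (s'.var 3) = 0)
    (fun k s h => h.1.var0) (fun k s v h => ?_) (fun k s' hk hx h => ?_)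
    ⟨hs, rfl, .inl h3, by simp⟩
  · obtain ⟨⟨h0, h1, h2, h3, h4, h5⟩, h⟩ := h
    exact ⟨⟨by simpa [State.setVar], by simpa [State.setVar], h2, h3, h4, h5⟩,
      by simpa [State.setVar] using h⟩
  · obtain ⟨⟨h0, h1, h2, h3, h4, h5⟩, h6, h7, h8⟩ := h
    by_cases hc : s.arr 5 k = 0
    · have : findBody.exec s' = s'.setVar 3 k := by
        simp [findBody, Prog.exec, Expr.eval, h6, hx, hc]
      rw [this]
      refine ⟨by simpa [State.setVar], ⟨by simpa [State.setVar], by simpa [State.setVar],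
        h2, h3, h4, h5⟩, h6, .inr (by simpa [State.setVar]), fun _ _ _ => ?_⟩
      simpa [State.setVar] using hc
    · have : findBody.exec s' = s' := by
        simp [findBody, Prog.exec, Expr.eval, h6, hx, hc]
      rw [this]
      refine ⟨hx, ⟨h0, h1, h2, h3, h4, h5⟩, h6, h7, fun i hi hi0 => ?_⟩
      rcases Nat.lt_succ_iff_lt_or_eq.1 hi with hi | rfl
      · exact h8 i hi hi0
      · exact absurd hi0 hc

theorem run_dispose {s : State} (hs : HasInput n m D s) :
    ∃ s' t, t ≤ (disposeBody.bound + 8) * m + 6 ∧ Run (.forLoop 2 1 disposeBody) s s' t ∧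
      HasInput n m D s' ∧ s'.var 3 = s.var 3 ∧ (∀ j, D.Valued j → s'.arr 4 j = s.arr 4 j) ∧
      ∀ j < m, ¬ D.Valued j → s'.arr 4 j = s.var 3 := by
  have hp : disposeBody.LoopFree := by simp [disposeBody, Prog.LoopFree]
  refine hp.run_forLoop (Inv := fun k s' => HasInput n m D s' ∧ s'.var 3 = s.var 3 ∧
    (∀ j, D.Valued j → s'.arr 4 j = s.arr 4 j) ∧
    ∀ j < k, ¬ D.Valued j → s'.arr 4 j = s.var 3)
    (fun k s h => h.1.var1) (fun k s v h => ?_) (fun k s' hk hx h => ?_)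
    ⟨hs, rfl, fun _ _ => rfl, by simp⟩
  · obtain ⟨⟨h0, h1, h2, h3, h4, h5⟩, h⟩ := h
    exact ⟨⟨by simpa [State.setVar], by simpa [State.setVar], h2, h3, h4, h5⟩,
      by simpa [State.setVar] using h⟩
  · obtain ⟨⟨h0, h1, h2, h3, h4, h5⟩, h6, h7, h8⟩ := h
    by_cases hv : D.Valued k
    · have : disposeBody.exec s' = s' := by
        have : ¬ D.fstValue k + D.sndValue k = 0 := by
          unfold ItemList.Valued at hv; omega
        simp only [disposeBody, Prog.exec, Expr.eval, h4, h5, hx, if_neg this]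
      rw [this]
      refine ⟨hx, ⟨h0, h1, h2, h3, h4, h5⟩, h6, h7, fun j hj hj0 => ?_⟩
      rcases Nat.lt_succ_iff_lt_or_eq.1 hj with hj | rfl
      · exact h8 j hj hj0
      · exact absurd hv hj0
    · have : disposeBody.exec s' = s'.setArr 4 k (s.var 3) := by
        have : D.fstValue k + D.sndValue k = 0 := by
          unfold ItemList.Valued at hv; omega
        simp only [disposeBody, Prog.exec, Expr.eval, h4, h5, hx, h6, if_pos this]
      rw [this]
      refine ⟨hx, ⟨h0, h1, ?_, ?_, ?_, ?_⟩, h6, fun j hj => ?_, fun j hj hj0 => ?_⟩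
      · simpa [State.setArr]
      · simpa [State.setArr]
      · simpa [State.setArr]
      · simpa [State.setArr]
      · have : j ≠ k := by rintro rfl; exact hv hj
        simpa [State.setArr, this] using h7 j hj
      · rcases Nat.lt_succ_iff_lt_or_eq.1 hj with hj | rfl
        · simpa [State.setArr, hj.ne] using h8 j hj hj0
        · simp [State.setArr]

theorem run_program {s : State} (hs : HasInput n m D s) (h3 : s.var 3 = 0)
    (h5 : ∀ i, s.arr 5 i = 0) :
    ∃ s' t r, t ≤ (assignBody.bound + transferBody.bound + findBody.bound + disposeBody.bound + 32)
        * (n + m) + 24 ∧ Run program s s' t ∧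
      (∀ j < m, D.Settled (s'.arr 4) (D.load (s'.arr 4) m) j) ∧ (r = 0 ∨ r < n) ∧
      (∀ i < n, D.load (s'.arr 4) m i = 0 → D.load (s'.arr 4) m r = 0) ∧
      ∀ j < m, ¬ D.Valued j → s'.arr 4 j = r := by
  obtain ⟨s₁, t₁, ht₁, r₁, i₁, v₁, a₁, c₁⟩ := run_assign hs h3 h5
  obtain ⟨s₂, t₂, ht₂, r₂, i₂, v₂, a₂, c₂⟩ := run_transfer i₁ v₁ a₁ c₁
  obtain ⟨s₃, t₃, ht₃, r₃, i₃, e₃, v₃, p₃⟩ := run_find i₂ v₂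
  obtain ⟨s₄, t₄, ht₄, r₄, -, -, a₄, w₄⟩ := run_dispose i₃
  rw [e₃] at a₄
  have hload : s₂.arr 5 = D.load (s₄.arr 4) m := by
    funext i
    rw [c₂]
    exact ItemList.load_congr fun j _ hv => (a₄ j hv).symm
  rw [hload] at p₃ a₂
  exact ⟨s₄, _, s₃.var 3, by nlinarith, .seq r₁ (.seq r₂ (.seq r₃ r₄)),
    fun j hj => (a₂ j hj).congr (a₄ j), v₃, p₃, w₄⟩

end EFXProgram

/-! ### The allocation computed by the program -/

namespace GraphicalInstance.EdgeList

open EFXProgram FairDivision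

variable {n m : ℕ} {I : GraphicalInstance (Fin n)} (L : I.EdgeList m)

/-- The item list in the initial memory of the instance. -/
noncomputable def itemList : ItemList :=
  ⟨L.input.arr 0, L.input.arr 1, L.input.arr 2, L.input.arr 3⟩

theorem hasInput : HasInput n m L.itemList L.input := ⟨rfl, rfl, rfl, rfl, rfl, rfl⟩

theorem itemList_fst (k : Fin m) : L.itemList.fst k = L.fst k := by simp [itemList, input]

theorem itemList_snd (k : Fin m) : L.itemList.snd k = L.snd k := by simp [itemList, input]

theorem itemList_fstValue (hI : I.IsBinary) (k : Fin m) :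
    L.itemList.fstValue k ≠ 0 ↔ 0 < I.value (L.fst k) (L.edge k) := by
  rcases hI (L.fst k) (L.edge k) with h | h <;> simp [itemList, input, h]

theorem itemList_sndValue (hI : I.IsBinary) (k : Fin m) :
    L.itemList.sndValue k ≠ 0 ↔ 0 < I.value (L.snd k) (L.edge k) := by
  rcases hI (L.snd k) (L.edge k) with h | h <;> simp [itemList, input, h]

theorem eq_fst_or_eq_snd {i : Fin n} {k : Fin m} (h : 0 < I.value i (L.edge k)) :
    i = L.fst k ∨ i = L.snd k := by
  have := I.mem_of_value_pos h
  rwa [L.edge_eq, Sym2.mem_iff] at this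

theorem itemList_valued (hI : I.IsBinary) (k : Fin m) :
    L.itemList.Valued k ↔ ∃ i, 0 < I.value i (L.edge k) := by
  rw [ItemList.Valued, L.itemList_fstValue hI, L.itemList_sndValue hI]
  refine ⟨fun h => h.elim (fun h => ⟨_, h⟩) fun h => ⟨_, h⟩, fun ⟨i, h⟩ => ?_⟩
  rcases L.eq_fst_or_eq_snd h with rfl | rfl
  exacts [.inl h, .inr h]

/-- A final memory of the program, with `own` the owners and `r` the recipient of the worthless
items, encodes an allocation to which `isEFX_of_isPoor` applies; the poor agents are those of load
`0`. -/
theorem exists_allocation (hI : I.IsBinary) {own : ℕ → ℕ} {r : ℕ}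
    (hset : ∀ j < m, L.itemList.Settled own (L.itemList.load own m) j) (hr : r = 0 ∨ r < n)
    (hr0 : ∀ i < n, L.itemList.load own m i = 0 → L.itemList.load own m r = 0)
    (hw : ∀ j < m, ¬ L.itemList.Valued j → own j = r) :
    ∃ Φ : I.Item → Fin n, (∀ k : Fin m, own k = Φ (L.edge k)) ∧
      IsNonWasteful I.value Φ ∧ IsEFX I.value Φ := by
  have hlt : ∀ k : Fin m, ∃ v : Fin n, own k = v := by
    intro k
    rcases hset k k.2 with ⟨-, h, -⟩ | ⟨-, h, -⟩ | h
    · exact ⟨_, h.trans (L.itemList_fst k)⟩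
    · exact ⟨_, h.trans (L.itemList_snd k)⟩
    · have := (L.fst k).pos
      exact ⟨⟨r, by omega⟩, hw k k.2 h⟩
  choose v hv using hlt
  obtain ⟨Φ, hΦ⟩ : ∃ Φ : I.Item → Fin n, ∀ k : Fin m, Φ (L.edge k) = v k :=
    ⟨fun e => v (L.edge.symm e), fun k => by simp⟩
  have hown : ∀ k : Fin m, own k = Φ (L.edge k) := fun k => by rw [hΦ, hv]
  have hnw : IsNonWasteful I.value Φ := by
    intro e he
    obtain ⟨k, rfl⟩ := L.edge.surjective e
    rcases hset k k.2 with ⟨ha, h, -⟩ | ⟨hb, h, -⟩ | h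
    · rw [hown, L.itemList_fst, ← Fin.ext_iff] at h
      rwa [h, ← L.itemList_fstValue hI]
    · rw [hown, L.itemList_snd, ← Fin.ext_iff] at h
      rwa [h, ← L.itemList_sndValue hI]
    · exact absurd ((L.itemList_valued hI k).2 he) h
  have hpoor : ∀ i : Fin n, IsPoor I.value Φ i ↔ L.itemList.load own m i = 0 := by
    intro i
    rw [ItemList.load_eq_zero]
    constructor
    · intro h j hj hval hji
      have h' := hnw _ ((L.itemList_valued hI ⟨j, hj⟩).1 hval)
      have hi : Φ (L.edge ⟨j, hj⟩) = i := Fin.ext ((hown ⟨j, hj⟩).symm.trans hji)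
      rw [hi] at h'
      exact h'.ne' (h _ hi)
    · intro h e he
      obtain ⟨k, rfl⟩ := L.edge.surjective e
      by_contra h0
      exact h k k.2 ((L.itemList_valued hI k).2 ⟨i, pos_iff_ne_zero.2 h0⟩) (by rw [hown, he])
  refine ⟨Φ, hown, hnw, I.isEFX_of_isPoor hI hnw (fun i hi e hie e' he' hee => ?_)
    fun e he i hi => ?_⟩
  · obtain ⟨k, rfl⟩ := L.edge.surjective e
    obtain ⟨k', rfl⟩ := L.edge.surjective e'
    have hval := (L.itemList_valued hI k).2 ⟨i, hie⟩
    have hval' := (L.itemList_valued hI k').2 ⟨_, he'⟩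
    have hne : own k ≠ i := ItemList.load_eq_zero.1 ((hpoor i).1 hi) k k.2 hval
    rw [hpoor] at hi
    have hload : L.itemList.load own m (own k) ≤ 1 := by
      rcases hset k k.2 with ⟨-, h, h'⟩ | ⟨-, h, h'⟩ | h
      · rcases L.eq_fst_or_eq_snd hie with rfl | rfl
        · exact absurd (h.trans (L.itemList_fst k)) hne
        · rw [h]
          exact h' ((L.itemList_sndValue hI k).2 hie) (by rwa [L.itemList_snd])
      · rcases L.eq_fst_or_eq_snd hie with rfl | rfl
        · exact absurd (by rwa [L.itemList_fst]) (h' ((L.itemList_fstValue hI k).2 hie))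
        · exact absurd (h.trans (L.itemList_snd k)) hne
      · exact absurd hval h
    rw [Fin.ext (ItemList.eq_of_load_le_one hload k.2 k'.2 hval hval' (by rw [hown, hown, hee]))]
  · obtain ⟨k, rfl⟩ := L.edge.surjective e
    rw [hpoor, ← hown, hw k k.2 (by simp [L.itemList_valued hI, he])]
    exact hr0 i i.2 ((hpoor i).1 hi)

end GraphicalInstance.EdgeList

open GraphicalInstance EFXProgram in
theorem exists_program_nonWasteful_EFX :
    ∃ (P : RAM.Prog) (p : Polynomial ℕ),
      ∀ (n m : ℕ) (I : GraphicalInstance (Fin n)) (L : I.EdgeList m), I.IsBinary →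
        ∃ (s : RAM.State) (t : ℕ) (Φ : I.Item → Fin n),
          RAM.Run P L.input s t ∧ t ≤ p.eval (n + m) ∧ L.Outputs s Φ ∧
          FairDivision.IsNonWasteful I.value Φ ∧ FairDivision.IsEFX I.value Φ := by
  refine ⟨program, .C (assignBody.bound + transferBody.bound + findBody.bound +
    disposeBody.bound + 32) * .X + .C 24, fun n m I L hI => ?_⟩
  obtain ⟨s, t, r, ht, hrun, hset, hr, hr0, hw⟩ := run_program L.hasInput rfl
    (fun i => by simp [EdgeList.input])
  obtain ⟨Φ, hout, hnw, hefx⟩ := L.exists_allocation hI hset hr hr0 hw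
  exact ⟨s, t, Φ, hrun, by simpa using ht, hout, hnw, hefx⟩

theorem mainTheorem5 :
    -- existence of a non-wasteful EFX allocation
    (∀ (V : Type*) [Fintype V] (I : GraphicalInstance V), I.IsBinary →
      ∃ Φ : I.Item → V, FairDivision.IsNonWasteful I.value Φ ∧ FairDivision.IsEFX I.value Φ) ∧
    -- one program finds such an allocation in time polynomial in the number of agents and items
    (∃ (P : RAM.Prog) (p : Polynomial ℕ),
      ∀ (n m : ℕ) (I : GraphicalInstance (Fin n)) (L : I.EdgeList m), I.IsBinary →
        ∃ (s : RAM.State) (t : ℕ) (Φ : I.Item → Fin n),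
          RAM.Run P L.input s t ∧ t ≤ p.eval (n + m) ∧ L.Outputs s Φ ∧
          FairDivision.IsNonWasteful I.value Φ ∧ FairDivision.IsEFX I.value Φ) ∧
    -- the price of EFX, over all instances and for each possible number of agents and items
    GraphicalInstance.priceOfEFX GraphicalInstance.binaryClass = 1 ∧
    (∀ n m : ℕ, 1 ≤ m → m ≤ n.choose 2 →
      GraphicalInstance.priceOfEFX (GraphicalInstance.binaryClassOfSize n m) = 1) :=
  ⟨fun _ _ I hI => I.exists_isNonWasteful_isEFX hI, exists_program_nonWasteful_EFX,
    (GraphicalInstance.priceOfEFX_binaryClassOfSize (n := 2) le_rfl (by decide)).2,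
    fun _ _ h1 hm => (GraphicalInstance.priceOfEFX_binaryClassOfSize h1 hm).1⟩
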